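/- **Setting.** Let $d\ge 1$ be an integer, $h_{\max}>0$, and let $\|\cdot\|$ be the Euclidean norm on $\mathbb R^d$ and the Frobenius norm $\|M\|=(\sum_{i,j}|M_{i,j}|^2)^{1/2}$ on the space $\mathcal M_d(\mathbb R)$ of real $d\times d$ matrices. Let $F:\mathbb R^d\to\mathbb R$ be of class $\mathcal C^3$ with bounded third order derivative, and assume that there exist $L_F,\mu\in(0,\infty)$ such that for all $x_1,x_2\in\mathbb R^d$ $$\|\nabla F(x_2)-\nabla F(x_1)\|\le L_F\|x_2-x_1\|,\qquad \langle\nabla F(x_2)-\nabla F(x_1),x_2-x_1\rangle\ge\mu\|x_2-x_1\|^2 .$$ Let $x^\star$ be the unique minimizer of $F$. Let $\sigma:[0,\infty)\times\mathbb R^d\to\mathcal M_d(\mathbb R)$ be continuous, and assume that there is a bounded function $\varsigma:[0,\infty)\to[0,\infty)$ such that for all $t\ge 0$ and $x_1,x_2\in\mathbb R^d$ $$\|\sigma(t,x_2)-\sigma(t,x_1)\|\le\varsigma(t)\|x_2-x_1\|,\qquad \sup_{x\in\mathbb R^d}\frac{\|\sigma(t,x)\|}{1+\|x-x^\star\|}\le\varsigma(t).$$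 For $h>0$ and $x_0\in\mathbb R^d$, let $(X_n)_{n\ge0}$ be defined by $X_0=x_0$ and $$X_{n+1}=X_n-h\nabla F(X_n)+h\,\sigma(nh,X_n)\gamma_{n+1},\qquad n\ge 0,$$ where $(\gamma_n)_{n\ge1}$ are independent standard centered Gaussian random vectors in $\mathbb R^d$, and let $\mathcal X^0$ be the solution on $[0,\infty)$ of $\frac{d}{dt}\mathcal X^0(t)=-\nabla F(\mathcal X^0(t))$, $\mathcal X^0(0)=x_0$. For $\varphi:\mathbb R^d\to\mathbb R$ of class $\mathcal C^2$ set $$|||\varphi|||_2=\sup_{x\in\mathbb R^d}\ \sup_{k_1,k_2\in\mathbb R^d\setminus\{0\}}\frac{|D^2\varphi(x).(k_1,k_2)|}{\|k_1\|\|k_2\|}.$$ **Proposition.** There exist $H\in(0,h_{\max})$ and $C\in(0,\infty)$ such that for every $\varphi:\mathbb R^d\to\mathbb R$ of class $\mathcal C^2$ with bounded second order derivative, every $x_0\in\mathbb R^d$ and every $h\in(0,H)$, the random variables $\varphi(X_N)$, $N\ge1$, are integrable and $$\sup_{N\ge1}\bigl|\mathbb E[\varphi(X_N)]-\varphi(\mathcal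 X^0(Nh))\bigr|\le C_1(\varphi,x_0)\,h,$$ where $$C_1(\varphi,x_0)=C\bigl(\|\nabla\varphi(x^\star)\|+|||\varphi|||_2\bigr)\bigl(1+\|x_0-x^\star\|^3\bigr).$$ The numbers $H$ and $C$ depend only on $d$, $h_{\max}$, $F$ and $\sigma$; in particular they do not depend on $\varphi$, $x_0$, $h$, $N$, or on the choice of the probability space and of the Gaussian vectors. -/

import Mathlib

open MeasureTheory ProbabilityTheory

noncomputable section

namespace StochGradScheme

/-- The Euclidean space `ℝ^d`. -/
abbrev E (d : ℕ) : Type := EuclideanSpace ℝ (Fin d)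

variable {d : ℕ}

/-- The norm `‖M‖ = (∑_{i,j} |M_{i,j}|²)^{1/2}` on square matrices. -/
def frobNorm (M : Matrix (Fin d) (Fin d) ℝ) : ℝ :=
  Real.sqrt (∑ i, ∑ j, |M i j| ^ 2)

/-- The derivative of order `m` of `φ` is bounded on `ℝ^d`. -/
def BoundedDeriv (m : ℕ) (φ : E d → ℝ) : Prop :=
  ∃ M : ℝ, ∀ x, ‖iteratedFDeriv ℝ m φ x‖ ≤ M

/-- The seminorm `|||φ|||_m`: the supremum over `x` and over nonzero directions `k₁, …, k_m` of
`|D^m φ(x).(k₁, …, k_m)| / (‖k₁‖ ⋯ ‖k_m‖)`. -/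
def tripleNorm (m : ℕ) (φ : E d → ℝ) : ℝ :=
  ⨆ p : E d × (Fin m → {k : E d // k ≠ 0}),
    |iteratedFDeriv ℝ m φ p.1 (fun i => (p.2 i : E d))| / ∏ i, ‖(p.2 i : E d)‖

/-- Basic assumptions on the objective function `F`: class `C³`, globally Lipschitz gradient,
`μ`-convexity for some `μ > 0`, bounded third order derivative. -/
structure ObjectiveAssumption (F : E d → ℝ) : Prop where
  contDiff : ContDiff ℝ 3 F
  lipschitz_gradient : ∃ L : ℝ, 0 < L ∧ ∀ x₁ x₂ : E d,
    ‖gradient F x₂ - gradient F x₁‖ ≤ L * ‖x₂ - x₁‖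
  mu_convex : ∃ μ : ℝ, 0 < μ ∧ ∀ x₁ x₂ : E d,
    μ * ‖x₂ - x₁‖ ^ 2 ≤ inner ℝ (gradient F x₂ - gradient F x₁) (x₂ - x₁)
  bounded_third : BoundedDeriv 3 F

/-- The minimizer `x⋆` of `F`. It exists and is unique under `ObjectiveAssumption F`, see
`minimizer_le` and `eq_minimizer`. -/
def minimizer (F : E d → ℝ) : E d :=
  Classical.epsilon fun x => ∀ y, F x ≤ F y

/-- Basic assumptions on the diffusion coefficient `σ` (only its values at times `t ≥ 0` matter):
joint continuity on `[0,∞) × ℝ^d`, and Lipschitz continuity and linear growth in space with a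
constant `ς(t)` which is bounded in time. -/
structure DiffusionAssumption (F : E d → ℝ) (σ : ℝ → E d → Matrix (Fin d) (Fin d) ℝ) : Prop where
  continuousOn : ContinuousOn (fun p : ℝ × E d => σ p.1 p.2) (Set.Ici 0 ×ˢ Set.univ)
  lipschitz_growth : ∃ ς : ℝ → ℝ,
    (∀ t, 0 ≤ t → 0 ≤ ς t) ∧
    (∀ t, 0 ≤ t → ∀ x₁ x₂ : E d, frobNorm (σ t x₂ - σ t x₁) ≤ ς t * ‖x₂ - x₁‖) ∧
    (∀ t, 0 ≤ t → ∀ x : E d, frobNorm (σ t x) / (1 + ‖x - minimizer F‖) ≤ ς t) ∧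
    BddAbove (ς '' Set.Ici 0)

/-- `X` solves the gradient system `X'(t) = -∇F(X(t))` for `t ≥ 0`, with `X(0) = x`. -/
def IsGradientFlow (F : E d → ℝ) (x : E d) (X : ℝ → E d) : Prop :=
  X 0 = x ∧ ∀ t, 0 ≤ t → HasDerivWithinAt X (-gradient F (X t)) (Set.Ici 0) t

/-- The solution of the gradient system with initial value `x`. Under `ObjectiveAssumption F` it
exists and is unique on `[0,∞)`, see `isGradientFlow_gradientFlow` and `eqOn_gradientFlow`. -/
def gradientFlow (F : E d → ℝ) (x : E d) : ℝ → E d :=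
  Classical.epsilon fun X => IsGradientFlow F x X

/-- The scheme `X_{n+1} = X_n - h ∇F(X_n) + h σ(nh, X_n) γ_{n+1}`, `X_0 = x₀`. The sequence
`(γ_n)_{n ≥ 1}` is indexed from zero: `γ n` is the `(n+1)`-th Gaussian vector. -/
def scheme {Ω : Type*} (F : E d → ℝ) (σ : ℝ → E d → Matrix (Fin d) (Fin d) ℝ) (h : ℝ) (x₀ : E d)
    (γ : ℕ → Ω → E d) : ℕ → Ω → E d
  | 0, _ => x₀
  | n + 1, ω =>
      scheme F σ h x₀ γ n ω - h • gradient F (scheme F σ h x₀ γ n ω)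
        + h • Matrix.toEuclideanLin (σ (n * h) (scheme F σ h x₀ γ n ω)) (γ n ω)

/-- `C₁(φ, x₀) = C (‖∇φ(x⋆)‖ + |||φ|||_2) (1 + ‖x₀ - x⋆‖³)`. -/
def weakConst (F : E d → ℝ) (C : ℝ) (φ : E d → ℝ) (x₀ : E d) : ℝ :=
  C * (‖gradient φ (minimizer F)‖ + tripleNorm 2 φ) * (1 + ‖x₀ - minimizer F‖ ^ 3)

/-! ### The minimizer and the gradient flow are well defined -/

theorem ObjectiveAssumption.hasGradientAt {F : E d → ℝ} (hF : ObjectiveAssumption F) (x : E d) :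
    HasGradientAt F (gradient F x) x :=
  ((hF.contDiff.differentiable (by norm_num)) x).hasGradientAt

theorem ObjectiveAssumption.contDiff_gradient {F : E d → ℝ} (hF : ObjectiveAssumption F) :
    ContDiff ℝ 2 (gradient F) := by
  have h : ContDiff ℝ 2 (fderiv ℝ F) := hF.contDiff.fderiv_right (by norm_num)
  exact (InnerProductSpace.toDual ℝ (E d)).symm.contDiff.comp h

theorem ObjectiveAssumption.exists_gradient_eq_zero {F : E d → ℝ} (hF : ObjectiveAssumption F) :
    ∃ x, gradient F x = 0 := by
  obtain ⟨L, hL, hLip⟩ := hF.lipschitz_gradient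
  obtain ⟨μ, hμ, hconv⟩ := hF.mu_convex
  set s : ℝ := μ / (L ^ 2 + μ ^ 2) with hs
  have hD : 0 < L ^ 2 + μ ^ 2 := by positivity
  have hs0 : 0 < s := by positivity
  have hq0 : 0 ≤ 1 - s * μ := by
    rw [hs, div_mul_eq_mul_div, sub_nonneg, div_le_one hD]
    nlinarith [sq_nonneg L]
  have hq1 : 1 - s * μ < 1 := by nlinarith [mul_pos hs0 hμ]
  have key : ∀ x y : E d, ‖(x - s • gradient F x) - (y - s • gradient F y)‖
      ≤ Real.sqrt (1 - s * μ) * ‖x - y‖ := by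
    intro x y
    have e : (x - s • gradient F x) - (y - s • gradient F y)
        = (x - y) - s • (gradient F x - gradient F y) := by
      rw [smul_sub]; abel
    have h1 := hLip y x
    have h2 := hconv y x
    have h3 : ‖gradient F x - gradient F y‖ ^ 2 ≤ L ^ 2 * ‖x - y‖ ^ 2 := by
      rw [← mul_pow]; gcongr
    have h4 : s * (L ^ 2 + μ ^ 2) = μ := by rw [hs]; field_simp
    have h5 : ‖(x - y) - s • (gradient F x - gradient F y)‖ ^ 2
        ≤ (1 - s * μ) * ‖x - y‖ ^ 2 := by
      rw [norm_sub_sq_real, inner_smul_right, norm_smul, mul_pow, Real.norm_eq_abs, sq_abs,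
        real_inner_comm]
      have h6 : s ^ 2 * L ^ 2 ≤ s * μ := by nlinarith [sq_nonneg (s * μ)]
      have h7 : s ^ 2 * ‖gradient F x - gradient F y‖ ^ 2 ≤ s * μ * ‖x - y‖ ^ 2 :=
        calc s ^ 2 * ‖gradient F x - gradient F y‖ ^ 2
            ≤ s ^ 2 * (L ^ 2 * ‖x - y‖ ^ 2) := by gcongr
          _ = s ^ 2 * L ^ 2 * ‖x - y‖ ^ 2 := by ring
          _ ≤ s * μ * ‖x - y‖ ^ 2 := by gcongr
      have h8 := mul_le_mul_of_nonneg_left h2 hs0.le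
      linarith
    rw [e]
    have h9 := Real.sqrt_le_sqrt h5
    rwa [Real.sqrt_sq (norm_nonneg _), Real.sqrt_mul hq0, Real.sqrt_sq (norm_nonneg _)] at h9
  have hc : ContractingWith (Real.toNNReal (Real.sqrt (1 - s * μ)))
      (fun x : E d => x - s • gradient F x) := by
    refine ⟨?_, LipschitzWith.of_dist_le_mul fun x y => ?_⟩
    · rw [Real.toNNReal_lt_one, Real.sqrt_lt' one_pos]
      linarith
    · rw [dist_eq_norm, dist_eq_norm, Real.coe_toNNReal _ (Real.sqrt_nonneg _)]
      exact key x y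
  refine ⟨ContractingWith.fixedPoint _ hc, ?_⟩
  have hfix := hc.fixedPoint_isFixedPt
  set z := ContractingWith.fixedPoint _ hc
  have h0 : z - s • gradient F z = z := hfix
  have h1 : s • gradient F z = 0 := by
    have := sub_eq_self.mp h0
    exact this
  exact (smul_eq_zero.mp h1).resolve_left hs0.ne'

theorem ObjectiveAssumption.le_of_gradient_eq_zero {F : E d → ℝ} (hF : ObjectiveAssumption F)
    {x : E d} (hx : gradient F x = 0) (y : E d) : F x ≤ F y := by
  obtain ⟨μ, hμ, hconv⟩ := hF.mu_convex
  have hder : ∀ t : ℝ, HasDerivAt (fun t : ℝ => F (x + t • (y - x)))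
      (inner ℝ (gradient F (x + t • (y - x))) (y - x)) t := by
    intro t
    have h1 : HasDerivAt (fun t : ℝ => x + t • (y - x)) (y - x) t := by
      simpa using ((hasDerivAt_id t).smul_const (y - x)).const_add x
    have h2 := (hF.hasGradientAt (x + t • (y - x))).hasFDerivAt.comp_hasDerivAt t h1
    rw [InnerProductSpace.toDual_apply_apply] at h2
    exact h2
  have hmono : MonotoneOn (fun t : ℝ => F (x + t • (y - x))) (Set.Icc 0 1) := by
    refine monotoneOn_of_deriv_nonneg (convex_Icc 0 1)
      (fun t _ => (hder t).continuousAt.continuousWithinAt)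
      (fun t _ => (hder t).differentiableAt.differentiableWithinAt) ?_
    intro t ht
    rw [interior_Icc] at ht
    rw [(hder t).deriv]
    have h3 := hconv x (x + t • (y - x))
    rw [hx, sub_zero, add_sub_cancel_left, inner_smul_right] at h3
    have h4 : 0 ≤ t * inner ℝ (gradient F (x + t • (y - x))) (y - x) :=
      le_trans (by positivity) h3
    exact nonneg_of_mul_nonneg_right h4 ht.1
  have := hmono (Set.left_mem_Icc.mpr zero_le_one) (Set.right_mem_Icc.mpr zero_le_one) zero_le_one
  simpa using this

theorem minimizer_le {F : E d → ℝ} (hF : ObjectiveAssumption F) (y : E d) :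
    F (minimizer F) ≤ F y := by
  obtain ⟨x, hx⟩ := hF.exists_gradient_eq_zero
  exact Classical.epsilon_spec (p := fun x => ∀ y, F x ≤ F y)
    ⟨x, hF.le_of_gradient_eq_zero hx⟩ y

theorem gradient_eq_zero_of_le {F : E d → ℝ} {x : E d} (hx : ∀ y, F x ≤ F y) :
    gradient F x = 0 := by
  have h : IsLocalMin F x := Filter.Eventually.of_forall hx
  rw [gradient, h.fderiv_eq_zero, map_zero]

theorem eq_minimizer {F : E d → ℝ} (hF : ObjectiveAssumption F) {x : E d}
    (hx : ∀ y, F x ≤ F y) : x = minimizer F := by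
  obtain ⟨μ, hμ, hconv⟩ := hF.mu_convex
  have h := hconv (minimizer F) x
  rw [gradient_eq_zero_of_le hx, gradient_eq_zero_of_le (minimizer_le hF), sub_zero,
    inner_zero_left] at h
  have h2 : ‖x - minimizer F‖ ^ 2 = 0 :=
    le_antisymm (nonpos_of_mul_nonpos_right h hμ) (sq_nonneg _)
  exact sub_eq_zero.mp (norm_eq_zero.mp (pow_eq_zero_iff two_ne_zero |>.mp h2))

theorem ObjectiveAssumption.lipschitzWith {F : E d → ℝ} (hF : ObjectiveAssumption F) :
    ∃ K : NNReal, LipschitzWith K (fun x => -gradient F x) := by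
  obtain ⟨L, hL, hLip⟩ := hF.lipschitz_gradient
  refine ⟨⟨L, hL.le⟩, LipschitzWith.of_dist_le_mul fun x y => ?_⟩
  rw [dist_neg_neg, dist_eq_norm, dist_eq_norm]
  exact hLip y x

theorem exists_isGradientFlow {F : E d → ℝ} (hF : ObjectiveAssumption F) (x : E d) :
    ∃ X, IsGradientFlow F x X := by
  obtain ⟨K, hK⟩ := hF.lipschitzWith
  have hε : (0 : ℝ) < 1 / (1 + K) := by positivity
  have hloc : ∀ y : E d, ∃ γ : ℝ → E d, γ 0 = y ∧
      IsMIntegralCurveOn (I := modelWithCornersSelf ℝ (E d)) γ (fun z => -gradient F z)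
        (Set.Ioo (-(1 / (1 + (K : ℝ)))) (1 / (1 + K))) := by
    intro y
    set ε : ℝ := 1 / (1 + K) with hεdef
    have hPL : IsPicardLindelof (fun _ z => -gradient F z)
        (⟨0, by constructor <;> linarith⟩ : Set.Icc (-ε) ε) y
        (‖gradient F y‖₊ + 1) 0 (‖gradient F y‖₊ + K * (‖gradient F y‖₊ + 1)) K := by
      refine ⟨fun _ _ => hK.lipschitzOnWith, fun _ _ => continuousOn_const, ?_, ?_⟩
      · intro _ _ z hz
        have h1 := hK.dist_le_mul z y
        rw [dist_eq_norm] at h1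
        have h2 : dist z y ≤ ‖gradient F y‖ + 1 := by simpa using hz
        have h3 : ‖-gradient F z‖ ≤ ‖-gradient F y‖ + ‖-gradient F z - -gradient F y‖ :=
          norm_le_norm_add_norm_sub' _ _
        rw [norm_neg (gradient F y)] at h3
        have h4 : (K : ℝ) * dist z y ≤ K * (‖gradient F y‖ + 1) := by gcongr
        push_cast
        linarith
      · have e : max (ε - 0) (0 - -ε) = ε := by simp
        push_cast
        rw [e, hεdef, mul_one_div, div_le_iff₀ (by positivity)]
        nlinarith [norm_nonneg (gradient F y), K.coe_nonneg]
    obtain ⟨α, h0, hα⟩ := hPL.exists_eq_forall_mem_Icc_hasDerivWithinAt₀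
    refine ⟨α, h0, fun t ht => ?_⟩
    have h1 := (hα t (Set.Ioo_subset_Icc_self ht)).mono Set.Ioo_subset_Icc_self
    exact h1.hasFDerivWithinAt.hasMFDerivWithinAt
  have hv : ContDiff ℝ 1 (fun z => -gradient F z) :=
    (hF.contDiff_gradient.of_le (by norm_num)).neg
  obtain ⟨γ, h0, hγ⟩ := exists_isMIntegralCurve_of_isMIntegralCurveOn
    (I := modelWithCornersSelf ℝ (E d)) (v := fun z => -gradient F z)
    (contMDiff_vectorSpace_iff_contDiff.mpr hv) hε hloc x
  refine ⟨γ, h0, fun t _ => ?_⟩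
  have h1 : HasFDerivAt γ
      (ContinuousLinearMap.toSpanSingleton ℝ (-gradient F (γ t))) t := by
    refine (hγ t).hasFDerivAt.congr_fderiv ?_
    ext
    rfl
  exact h1.hasDerivAt.hasDerivWithinAt.congr_deriv (by simp)

theorem isGradientFlow_gradientFlow {F : E d → ℝ} (hF : ObjectiveAssumption F) (x : E d) :
    IsGradientFlow F x (gradientFlow F x) :=
  Classical.epsilon_spec (exists_isGradientFlow hF x)

theorem eqOn_gradientFlow {F : E d → ℝ} (hF : ObjectiveAssumption F) {x : E d} {X : ℝ → E d}
    (hX : IsGradientFlow F x X) : Set.EqOn X (gradientFlow F x) (Set.Ici 0) := by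
  obtain ⟨K, hK⟩ := hF.lipschitzWith
  have hG := isGradientFlow_gradientFlow hF x
  intro t ht
  have aux : ∀ Y : ℝ → E d, IsGradientFlow F x Y → ContinuousOn Y (Set.Icc 0 t) ∧
      ∀ s ∈ Set.Ico 0 t, HasDerivWithinAt Y (-gradient F (Y s)) (Set.Ici s) s := fun Y hY =>
    ⟨fun s hs => ((hY.2 s hs.1).continuousWithinAt).mono Set.Icc_subset_Ici_self,
      fun s hs => (hY.2 s hs.1).mono (Set.Ici_subset_Ici.mpr hs.1)⟩
  exact ODE_solution_unique (v := fun _ z => -gradient F z) (fun _ => hK)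
    (aux _ hX).1 (aux _ hX).2 (aux _ hG).1 (aux _ hG).2 (hX.1.trans hG.1.symm)
    (Set.right_mem_Icc.mpr ht)

end StochGradScheme

end

open StochGradScheme

/-!
Compare the scheme `X_n` with the noiseless Euler iterates `y_n` for the same step `h`. The Euler
step contracts by a factor `1 - hμ/2`, while one step of noise has variance of order `h²` because
the noise carries a factor `h`; hence `𝔼 ‖X_n - y_n‖² = O(h)` uniformly in `n`. Centred noise enters
the mean only through the second order Taylor remainder of the Euler step, whose derivative has
Lipschitz constant of order `h`, so `𝔼 X_n - y_n = O(h)` as well. Expanding `φ` at `y_n` combines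
the two bounds, and `y_n` differs from the flow at time `nh` by `O(h)`.
-/

open scoped NNReal

namespace StochGradScheme

section Calculus

variable {V W : Type*} [NormedAddCommGroup V] [NormedSpace ℝ V]
  [NormedAddCommGroup W] [NormedSpace ℝ W] {f : V → W} {K : ℝ≥0}

theorem lipschitzWith_fderiv_of_norm_iteratedFDeriv_two_le (hf : ContDiff ℝ 2 f)
    (hK : ∀ x, ‖iteratedFDeriv ℝ 2 f x‖ ≤ K) : LipschitzWith K (fderiv ℝ f) := by
  have hdiff : Differentiable ℝ (fderiv ℝ f) :=
    (hf.fderiv_right (m := 1) (by norm_num)).differentiable one_ne_zero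
  refine lipschitzWith_of_nnnorm_fderiv_le hdiff fun x => ?_
  rw [← NNReal.coe_le_coe, coe_nnnorm, ← norm_iteratedFDeriv_one, norm_iteratedFDeriv_fderiv]
  exact hK x

theorem norm_fderiv_le_of_norm_sub_le (hK : LipschitzWith K (fderiv ℝ f)) {x z : V} {r : ℝ}
    (hx : ‖x - z‖ ≤ r) : ‖fderiv ℝ f x‖ ≤ ‖fderiv ℝ f z‖ + K * r :=
  calc ‖fderiv ℝ f x‖ ≤ ‖fderiv ℝ f z‖ + ‖fderiv ℝ f x - fderiv ℝ f z‖ :=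
        norm_le_norm_add_norm_sub' _ _
    _ ≤ ‖fderiv ℝ f z‖ + K * ‖x - z‖ := by gcongr; exact hK.norm_sub_le x z
    _ ≤ ‖fderiv ℝ f z‖ + K * r := by gcongr

theorem norm_sub_le_of_lipschitzWith_fderiv (hf : Differentiable ℝ f)
    (hK : LipschitzWith K (fderiv ℝ f)) {x y z : V} {r : ℝ} (hx : ‖x - z‖ ≤ r)
    (hy : ‖y - z‖ ≤ r) : ‖f x - f y‖ ≤ (‖fderiv ℝ f z‖ + K * r) * ‖x - y‖ :=
  (convex_closedBall z r).norm_image_sub_le_of_norm_fderiv_le (𝕜 := ℝ) (fun u _ => hf u)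
    (fun _ hu => norm_fderiv_le_of_norm_sub_le hK (mem_closedBall_iff_norm.mp hu))
    (mem_closedBall_iff_norm.mpr hy) (mem_closedBall_iff_norm.mpr hx)

theorem norm_sub_sub_fderiv_le (hf : Differentiable ℝ f) (hK : LipschitzWith K (fderiv ℝ f))
    (x y : V) : ‖f y - f x - fderiv ℝ f x (y - x)‖ ≤ K * ‖y - x‖ ^ 2 := by
  have hbound : ∀ u ∈ Metric.closedBall x ‖y - x‖,
      ‖fderiv ℝ f u - fderiv ℝ f x‖ ≤ K * ‖y - x‖ := fun u hu =>
    (hK.norm_sub_le u x).trans (by gcongr; exact mem_closedBall_iff_norm.mp hu)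
  rw [sq, ← mul_assoc]
  exact (convex_closedBall x ‖y - x‖).norm_image_sub_le_of_norm_fderiv_le' (𝕜 := ℝ)
    (fun u _ => hf u) hbound (Metric.mem_closedBall_self (norm_nonneg _))
    (mem_closedBall_iff_norm.mpr le_rfl)

theorem norm_clm_apply_sq_le (T : V →L[ℝ] W) (v : V) : ‖T v‖ ^ 2 ≤ ‖T‖ ^ 2 * ‖v‖ ^ 2 := by
  rw [← mul_pow]
  gcongr
  exact T.le_opNorm v

end Calculus

section IndependentOperator

variable {Ω U V : Type*} [MeasurableSpace Ω] {P : Measure Ω}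
  [NormedAddCommGroup U] [NormedSpace ℝ U] [MeasurableSpace U] [BorelSpace U]
  {ξ : Ω → U}

section NormedSpace

variable [NormedAddCommGroup V] [NormedSpace ℝ V] {A : Ω → U →L[ℝ] V}

theorem integrable_norm_sq_mul_norm_sq (hA : MemLp A 2 P) (hξ : MemLp ξ 2 P)
    (hind : IndepFun A ξ P) : Integrable (fun ω => ‖A ω‖ ^ 2 * ‖ξ ω‖ ^ 2) P :=
  (hind.comp (measurable_norm.pow_const 2) (measurable_norm.pow_const 2)).integrable_mul
    hA.norm.integrable_sq hξ.norm.integrable_sq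

theorem memLp_two_clm_apply (hA : MemLp A 2 P) (hξ : MemLp ξ 2 P) (hind : IndepFun A ξ P) :
    MemLp (fun ω => A ω (ξ ω)) 2 P := by
  have hmeas : AEStronglyMeasurable (fun ω => A ω (ξ ω)) P :=
    (ContinuousLinearMap.id ℝ (U →L[ℝ] V)).aestronglyMeasurable_comp₂ hA.1 hξ.1
  rw [memLp_two_iff_integrable_sq_norm hmeas]
  refine (integrable_norm_sq_mul_norm_sq hA hξ hind).mono' (hmeas.norm.pow 2) (.of_forall ?_)
  intro ω
  rw [Real.norm_of_nonneg (by positivity)]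
  exact norm_clm_apply_sq_le (A ω) (ξ ω)

theorem integral_norm_clm_apply_sq_le (hA : MemLp A 2 P) (hξ : MemLp ξ 2 P)
    (hind : IndepFun A ξ P) :
    ∫ ω, ‖A ω (ξ ω)‖ ^ 2 ∂P ≤ (∫ ω, ‖A ω‖ ^ 2 ∂P) * ∫ ω, ‖ξ ω‖ ^ 2 ∂P :=
  calc ∫ ω, ‖A ω (ξ ω)‖ ^ 2 ∂P ≤ ∫ ω, ‖A ω‖ ^ 2 * ‖ξ ω‖ ^ 2 ∂P :=
        integral_mono (memLp_two_clm_apply hA hξ hind).norm.integrable_sq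
          (integrable_norm_sq_mul_norm_sq hA hξ hind) fun ω => norm_clm_apply_sq_le (A ω) (ξ ω)
    _ = (∫ ω, ‖A ω‖ ^ 2 ∂P) * ∫ ω, ‖ξ ω‖ ^ 2 ∂P :=
        (hind.comp (measurable_norm.pow_const 2)
          (measurable_norm.pow_const 2)).integral_fun_mul_eq_mul_integral
          hA.norm.integrable_sq.1 hξ.norm.integrable_sq.1

theorem integral_clm_apply_eq_zero [CompleteSpace U] [CompleteSpace V] (hA : Integrable A P)
    (hξ : Integrable ξ P) (hξ₀ : ∫ ω, ξ ω ∂P = 0) (hind : IndepFun A ξ P) :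
    ∫ ω, A ω (ξ ω) ∂P = 0 := by
  have h := hind.integral_bilin hA hξ (ContinuousLinearMap.id ℝ (U →L[ℝ] V))
  rwa [hξ₀, map_zero] at h

end NormedSpace

variable [CompleteSpace U] [IsFiniteMeasure P] [NormedAddCommGroup V] [InnerProductSpace ℝ V]
  {𝓧 : Type*} [MeasurableSpace 𝓧] {X : Ω → 𝓧} {u : 𝓧 → V} {S : 𝓧 → U →L[ℝ] V}

theorem integral_inner_clm_apply_eq_zero (hu : StronglyMeasurable u) (hS : StronglyMeasurable S)
    (huX : MemLp (fun ω => u (X ω)) 2 P) (hSX : MemLp (fun ω => S (X ω)) 2 P)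
    (hξ : MemLp ξ 2 P) (hξ₀ : ∫ ω, ξ ω ∂P = 0) (hind : IndepFun X ξ P) :
    ∫ ω, inner ℝ (u (X ω)) (S (X ω) (ξ ω)) ∂P = 0 := by
  have hcont : Continuous fun p : V × (U →L[ℝ] V) => (innerSL ℝ p.1).comp p.2 := by fun_prop
  have hint : Integrable (fun ω => (innerSL ℝ (u (X ω))).comp (S (X ω))) P := by
    refine (huX.norm.integrable_mul hSX.norm).mono'
      (hcont.comp_aestronglyMeasurable (huX.1.prodMk hSX.1)) (.of_forall fun ω => ?_)
    simpa only [Pi.mul_apply, innerSL_apply_norm] using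
      (innerSL ℝ (u (X ω))).opNorm_comp_le (S (X ω))
  have hind' : IndepFun (fun ω => (innerSL ℝ (u (X ω))).comp (S (X ω))) ξ P :=
    hind.comp (hcont.comp_stronglyMeasurable (hu.prodMk hS)).measurable measurable_id
  exact integral_clm_apply_eq_zero hint (hξ.integrable one_le_two) hξ₀ hind'

theorem integral_norm_add_clm_apply_sq (hu : StronglyMeasurable u) (hS : StronglyMeasurable S)
    (huX : MemLp (fun ω => u (X ω)) 2 P) (hSX : MemLp (fun ω => S (X ω)) 2 P)
    (hξ : MemLp ξ 2 P) (hξ₀ : ∫ ω, ξ ω ∂P = 0) (hind : IndepFun X ξ P) :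
    ∫ ω, ‖u (X ω) + S (X ω) (ξ ω)‖ ^ 2 ∂P
      = ∫ ω, ‖u (X ω)‖ ^ 2 ∂P + ∫ ω, ‖S (X ω) (ξ ω)‖ ^ 2 ∂P := by
  have hSξ : MemLp (fun ω => S (X ω) (ξ ω)) 2 P :=
    memLp_two_clm_apply hSX hξ (hind.comp hS.measurable measurable_id)
  have hinner : Integrable (fun ω => inner ℝ (u (X ω)) (S (X ω) (ξ ω))) P :=
    (huX.norm.integrable_mul hSξ.norm).mono' (huX.1.inner hSξ.1)
      (.of_forall fun ω => norm_inner_le_norm _ _)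
  simp_rw [norm_add_sq_real]
  rw [integral_add (f := fun ω => ‖u (X ω)‖ ^ 2 + 2 * inner ℝ (u (X ω)) (S (X ω) (ξ ω)))
      (huX.norm.integrable_sq.add (hinner.const_mul 2)) hSξ.norm.integrable_sq,
    integral_add huX.norm.integrable_sq (hinner.const_mul 2), integral_const_mul,
    integral_inner_clm_apply_eq_zero hu hS huX hSX hξ hξ₀ hind, mul_zero, add_zero]

end IndependentOperator

section TaylorMean

variable {Ω V W : Type*} [MeasurableSpace Ω] {P : Measure Ω} [IsProbabilityMeasure P]
  [NormedAddCommGroup V] [NormedSpace ℝ V] [NormedAddCommGroup W] [NormedSpace ℝ W]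
  {X : Ω → V} {f : V → W} {K : ℝ≥0}

theorem integrable_sub_sub_fderiv (hf : Differentiable ℝ f) (hK : LipschitzWith K (fderiv ℝ f))
    (hX : MemLp X 2 P) (y : V) :
    Integrable (fun ω => f (X ω) - f y - fderiv ℝ f y (X ω - y)) P := by
  have hcont : Continuous fun x => f x - f y - fderiv ℝ f y (x - y) := by
    have := hf.continuous
    fun_prop
  exact ((hX.sub (memLp_const y)).norm.integrable_sq.const_mul (K : ℝ)).mono'
    (hcont.comp_aestronglyMeasurable hX.1)
    (.of_forall fun ω => norm_sub_sub_fderiv_le hf hK y (X ω))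

theorem integrable_comp_of_lipschitzWith_fderiv (hf : Differentiable ℝ f)
    (hK : LipschitzWith K (fderiv ℝ f)) (hX : MemLp X 2 P) :
    Integrable (fun ω => f (X ω)) P := by
  have hlin : Integrable (fun ω => fderiv ℝ f 0 (X ω - 0)) P :=
    (fderiv ℝ f 0).integrable_comp ((hX.integrable one_le_two).sub (integrable_const 0))
  refine (((integrable_sub_sub_fderiv hf hK hX 0).add hlin).add (integrable_const (f 0))).congr ?_
  exact .of_forall fun ω => by simp

theorem norm_integral_comp_sub_le [CompleteSpace V] [CompleteSpace W] (hf : Differentiable ℝ f)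
    (hK : LipschitzWith K (fderiv ℝ f)) (hX : MemLp X 2 P) (y : V) :
    ‖∫ ω, f (X ω) ∂P - f y‖
      ≤ ‖fderiv ℝ f y‖ * ‖∫ ω, X ω ∂P - y‖ + K * ∫ ω, ‖X ω - y‖ ^ 2 ∂P := by
  have hXy : Integrable (fun ω => X ω - y) P :=
    (hX.integrable one_le_two).sub (integrable_const y)
  have hfy : Integrable (fun ω => f (X ω) - f y) P :=
    (integrable_comp_of_lipschitzWith_fderiv hf hK hX).sub (integrable_const (f y))
  have hremainder : ‖∫ ω, (f (X ω) - f y - fderiv ℝ f y (X ω - y)) ∂P‖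
      ≤ K * ∫ ω, ‖X ω - y‖ ^ 2 ∂P := by
    rw [← integral_const_mul]
    exact norm_integral_le_of_norm_le
      ((hX.sub (memLp_const y)).norm.integrable_sq.const_mul (K : ℝ))
      (.of_forall fun ω => norm_sub_sub_fderiv_le hf hK y (X ω))
  have hsplit : ∫ ω, f (X ω) ∂P - f y = fderiv ℝ f y (∫ ω, X ω ∂P - y)
      + ∫ ω, (f (X ω) - f y - fderiv ℝ f y (X ω - y)) ∂P := by
    rw [integral_sub hfy ((fderiv ℝ f y).integrable_comp hXy),
      (fderiv ℝ f y).integral_comp_comm hXy,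
      integral_sub (integrable_comp_of_lipschitzWith_fderiv hf hK hX) (integrable_const _),
      integral_sub (hX.integrable one_le_two) (integrable_const _)]
    simp
  rw [hsplit]
  exact (norm_add_le _ _).trans (add_le_add ((fderiv ℝ f y).le_opNorm _) hremainder)

end TaylorMean

section LinearGrowth

/-- `S` is strongly measurable and grows at most linearly away from `z`, with constant `s`. -/
structure HasLinearGrowth {V G : Type*} [NormedAddCommGroup V] [MeasurableSpace V]
    [NormedAddCommGroup G] (S : V → G) (z : V) (s : ℝ) : Prop where
  stronglyMeasurable : StronglyMeasurable S
  norm_le : ∀ x, ‖S x‖ ≤ s * (1 + ‖x - z‖)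

variable {Ω V G : Type*} [MeasurableSpace Ω] {P : Measure Ω} [IsProbabilityMeasure P]
  [NormedAddCommGroup V] [MeasurableSpace V] [NormedAddCommGroup G]
  {S : V → G} {z : V} {s : ℝ} {X : Ω → V}

theorem HasLinearGrowth.const_smul [NormedSpace ℝ G] (hS : HasLinearGrowth S z s) {c : ℝ}
    (hc : 0 ≤ c) : HasLinearGrowth (fun x => c • S x) z (c * s) where
  stronglyMeasurable := hS.stronglyMeasurable.const_smul c
  norm_le x := by
    rw [norm_smul, Real.norm_of_nonneg hc, mul_assoc]
    gcongr
    exact hS.norm_le x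

theorem HasLinearGrowth.memLp_two_comp (hS : HasLinearGrowth S z s) (hXm : Measurable X)
    (hX : MemLp X 2 P) : MemLp (fun ω => S (X ω)) 2 P := by
  have hbound : MemLp (fun ω => s * (1 + ‖X ω - z‖)) 2 P :=
    ((memLp_const (1 : ℝ)).add (hX.sub (memLp_const z)).norm).const_mul s
  exact hbound.mono' (hS.stronglyMeasurable.comp_measurable hXm).aestronglyMeasurable
    (.of_forall fun ω => hS.norm_le (X ω))

theorem HasLinearGrowth.integral_norm_comp_sq_le (hS : HasLinearGrowth S z s)
    (hXm : Measurable X) (hX : MemLp X 2 P) :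
    ∫ ω, ‖S (X ω)‖ ^ 2 ∂P ≤ 2 * s ^ 2 * (1 + ∫ ω, ‖X ω - z‖ ^ 2 ∂P) := by
  have hsq : Integrable (fun ω => ‖X ω - z‖ ^ 2) P := (hX.sub (memLp_const z)).norm.integrable_sq
  have hpoint : ∀ ω, ‖S (X ω)‖ ^ 2 ≤ 2 * s ^ 2 * (1 + ‖X ω - z‖ ^ 2) := fun ω =>
    calc ‖S (X ω)‖ ^ 2 ≤ (s * (1 + ‖X ω - z‖)) ^ 2 := by gcongr; exact hS.norm_le (X ω)
      _ = s ^ 2 * (1 + ‖X ω - z‖) ^ 2 := mul_pow ..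
      _ ≤ s ^ 2 * (2 * (1 ^ 2 + ‖X ω - z‖ ^ 2)) := by gcongr; exact add_sq_le
      _ = 2 * s ^ 2 * (1 + ‖X ω - z‖ ^ 2) := by ring
  calc ∫ ω, ‖S (X ω)‖ ^ 2 ∂P ≤ ∫ ω, 2 * s ^ 2 * (1 + ‖X ω - z‖ ^ 2) ∂P :=
        integral_mono (hS.memLp_two_comp hXm hX).norm.integrable_sq
          (((integrable_const 1).add hsq).const_mul _) hpoint
    _ = 2 * s ^ 2 * (1 + ∫ ω, ‖X ω - z‖ ^ 2 ∂P) := by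
        rw [integral_const_mul, integral_add (integrable_const 1) hsq, integral_const,
          probReal_univ, one_smul]

end LinearGrowth

theorem memLp_two_comp_of_lipschitzWith {Ω V W : Type*} [MeasurableSpace Ω] {P : Measure Ω}
    [IsFiniteMeasure P] [NormedAddCommGroup V] [NormedAddCommGroup W] {X : Ω → V} {T : V → W}
    {ρ : ℝ≥0} (hT : LipschitzWith ρ T) (hX : MemLp X 2 P) : MemLp (fun ω => T (X ω)) 2 P := by
  have hshift : LipschitzWith ρ fun x => T x - T 0 := by
    simpa using hT.sub (LipschitzWith.const (T 0))
  refine ((hshift.comp_memLp (sub_self _) hX).add (memLp_const (T 0))).ae_eq (.of_forall ?_)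
  exact fun ω => sub_add_cancel _ _

section NoisyStep

variable {Ω U V : Type*} [MeasurableSpace Ω] {P : Measure Ω} [IsProbabilityMeasure P]
  [NormedAddCommGroup U] [NormedSpace ℝ U] [MeasurableSpace U] [BorelSpace U]
  [NormedAddCommGroup V] [InnerProductSpace ℝ V] [MeasurableSpace V]
  {X : Ω → V} {ξ : Ω → U} {S : V → U →L[ℝ] V} {T : V → V} {z : V} {s : ℝ} {ρ : ℝ≥0}

theorem HasLinearGrowth.memLp_two_apply (hS : HasLinearGrowth S z s) (hXm : Measurable X)
    (hX : MemLp X 2 P) (hξ : MemLp ξ 2 P) (hind : IndepFun X ξ P) :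
    MemLp (fun ω => S (X ω) (ξ ω)) 2 P :=
  memLp_two_clm_apply (hS.memLp_two_comp hXm hX) hξ
    (hind.comp hS.stronglyMeasurable.measurable measurable_id)

theorem integral_norm_noisyStep_sub_sq_le [BorelSpace V] [SecondCountableTopology V]
    [CompleteSpace U] (hT : LipschitzWith ρ T) (hρ : ρ ≤ 1) (hS : HasLinearGrowth S z s)
    {κ : ℝ} (hXm : Measurable X) (hX : MemLp X 2 P) (hξ : MemLp ξ 2 P)
    (hξ₀ : ∫ ω, ξ ω ∂P = 0) (hξκ : ∫ ω, ‖ξ ω‖ ^ 2 ∂P ≤ κ) (hind : IndepFun X ξ P) (y : V) :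
    ∫ ω, ‖T (X ω) + S (X ω) (ξ ω) - T y‖ ^ 2 ∂P
      ≤ ρ * ∫ ω, ‖X ω - y‖ ^ 2 ∂P + 2 * s ^ 2 * κ * (1 + ∫ ω, ‖X ω - z‖ ^ 2 ∂P) := by
  have hdrift : MemLp (fun ω => T (X ω) - T y) 2 P :=
    (memLp_two_comp_of_lipschitzWith hT hX).sub (memLp_const (T y))
  have hSX : MemLp (fun ω => S (X ω)) 2 P := hS.memLp_two_comp hXm hX
  have hcontract : ∀ x, ‖T x - T y‖ ^ 2 ≤ ρ * ‖x - y‖ ^ 2 := fun x =>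
    calc ‖T x - T y‖ ^ 2 ≤ (ρ * ‖x - y‖) ^ 2 := by gcongr; exact hT.norm_sub_le x y
      _ = ρ * (ρ * ‖x - y‖ ^ 2) := by ring
      _ ≤ ρ * ‖x - y‖ ^ 2 := by gcongr; exact mul_le_of_le_one_left (by positivity) hρ
  have hdrift_le : ∫ ω, ‖T (X ω) - T y‖ ^ 2 ∂P ≤ ρ * ∫ ω, ‖X ω - y‖ ^ 2 ∂P := by
    rw [← integral_const_mul]
    exact integral_mono hdrift.norm.integrable_sq
      ((hX.sub (memLp_const y)).norm.integrable_sq.const_mul _) fun ω => hcontract (X ω)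
  have hnoise_le : ∫ ω, ‖S (X ω) (ξ ω)‖ ^ 2 ∂P
      ≤ 2 * s ^ 2 * κ * (1 + ∫ ω, ‖X ω - z‖ ^ 2 ∂P) :=
    calc ∫ ω, ‖S (X ω) (ξ ω)‖ ^ 2 ∂P ≤ (∫ ω, ‖S (X ω)‖ ^ 2 ∂P) * ∫ ω, ‖ξ ω‖ ^ 2 ∂P :=
          integral_norm_clm_apply_sq_le hSX hξ
            (hind.comp hS.stronglyMeasurable.measurable measurable_id)
      _ ≤ 2 * s ^ 2 * (1 + ∫ ω, ‖X ω - z‖ ^ 2 ∂P) * κ := by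
          gcongr
          exact hS.integral_norm_comp_sq_le hXm hX
      _ = 2 * s ^ 2 * κ * (1 + ∫ ω, ‖X ω - z‖ ^ 2 ∂P) := by ring
  simp_rw [add_sub_right_comm]
  rw [integral_norm_add_clm_apply_sq (u := fun x => T x - T y)
    (hT.continuous.sub continuous_const).stronglyMeasurable hS.stronglyMeasurable hdrift hSX hξ
    hξ₀ hind]
  exact add_le_add hdrift_le hnoise_le

end NoisyStep

section NoisyIterate

/-- Noise of an iteration driven by independent centred random vectors whose second moments are
bounded by `κ`. -/
structure IsCenteredNoise {Ω U : Type*} [MeasurableSpace Ω] [NormedAddCommGroup U]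
    [NormedSpace ℝ U] [MeasurableSpace U] (ξ : ℕ → Ω → U) (κ : ℝ) (P : Measure Ω) : Prop where
  measurable : ∀ n, Measurable (ξ n)
  memLp_two : ∀ n, MemLp (ξ n) 2 P
  integral_eq_zero : ∀ n, ∫ ω, ξ n ω ∂P = 0
  integral_norm_sq_le : ∀ n, ∫ ω, ‖ξ n ω‖ ^ 2 ∂P ≤ κ
  iIndepFun : iIndepFun ξ P

/-- The random sequence `X_{n+1} = T X_n + S_n(X_n) ξ_n`, `X_0 = x₀`. -/
def noisyIterate {Ω U V : Type*} [NormedAddCommGroup U] [NormedSpace ℝ U]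
    [NormedAddCommGroup V] [NormedSpace ℝ V] (T : V → V) (S : ℕ → V → U →L[ℝ] V)
    (ξ : ℕ → Ω → U) (x₀ : V) : ℕ → Ω → V
  | 0, _ => x₀
  | n + 1, ω => T (noisyIterate T S ξ x₀ n ω)
      + S n (noisyIterate T S ξ x₀ n ω) (ξ n ω)

theorem IsCenteredNoise.nonneg {Ω U : Type*} [MeasurableSpace Ω] [NormedAddCommGroup U]
    [NormedSpace ℝ U] [MeasurableSpace U] {ξ : ℕ → Ω → U} {κ : ℝ} {P : Measure Ω}
    (hξ : IsCenteredNoise ξ κ P) : 0 ≤ κ :=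
  (integral_nonneg fun _ => sq_nonneg _).trans (hξ.integral_norm_sq_le 0)

theorem le_of_contracting_recursion {a : ℕ → ℝ} {ρ K : ℝ} (hρ : 0 ≤ ρ) (h₀ : a 0 ≤ K)
    (hsucc : ∀ n, a (n + 1) ≤ ρ * a n + (1 - ρ) * K) (n : ℕ) : a n ≤ K := by
  induction n with
  | zero => exact h₀
  | succ n ih => linarith [hsucc n, mul_le_mul_of_nonneg_left ih hρ]

theorem norm_iterate_sub_le_of_isFixedPt {V : Type*} [NormedAddCommGroup V] {T : V → V} {z : V}
    {ρ : ℝ≥0} (hT : LipschitzWith ρ T) (hρ : ρ ≤ 1) (hz : Function.IsFixedPt T z) (x : V) (n : ℕ) :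
    ‖T^[n] x - z‖ ≤ ‖x - z‖ :=
  calc ‖T^[n] x - z‖ = ‖T^[n] x - T^[n] z‖ := by rw [hz.iterate n]
    _ ≤ (ρ ^ n : ℝ≥0) * ‖x - z‖ := (hT.iterate n).norm_sub_le x z
    _ ≤ ‖x - z‖ := mul_le_of_le_one_left (norm_nonneg _) (pow_le_one₀ ρ.coe_nonneg hρ)

variable {Ω U V : Type*}
  [NormedAddCommGroup U] [NormedSpace ℝ U] [MeasurableSpace U] [BorelSpace U]
  [SecondCountableTopology U]
  [NormedAddCommGroup V] [InnerProductSpace ℝ V] [MeasurableSpace V] [BorelSpace V]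
  [SecondCountableTopology V]
  {T : V → V} {S : ℕ → V → U →L[ℝ] V} {ξ : ℕ → Ω → U} {x₀ z : V} {s κ : ℝ} {ρ m : ℝ≥0}

theorem measurable_noisyIterate_iSup_comap (hT : Continuous T)
    (hS : ∀ n, StronglyMeasurable (S n)) (n : ℕ) :
    Measurable[⨆ i ∈ Set.Iio n, MeasurableSpace.comap (ξ i) inferInstance]
      (noisyIterate T S ξ x₀ n) := by
  induction n with
  | zero => exact measurable_const
  | succ n ih =>
    have hX := ih.mono (biSup_mono fun i hi => hi.trans n.lt_succ_self :
      _ ≤ ⨆ i ∈ Set.Iio (n + 1), MeasurableSpace.comap (ξ i) inferInstance) le_rfl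
    have hξn : Measurable[⨆ i ∈ Set.Iio (n + 1), MeasurableSpace.comap (ξ i) inferInstance] (ξ n) :=
      (comap_measurable (ξ n)).mono (le_biSup (fun i => MeasurableSpace.comap (ξ i) inferInstance)
        (Set.mem_Iio.mpr n.lt_succ_self)) le_rfl
    have happly : StronglyMeasurable fun p : V × U => S n p.1 p.2 :=
      isBoundedBilinearMap_apply.continuous.comp_stronglyMeasurable
        (((hS n).comp_measurable measurable_fst).prodMk measurable_snd.stronglyMeasurable)
    have hstep : Measurable fun p : V × U => T p.1 + S n p.1 p.2 :=
      (hT.measurable.comp measurable_fst).add happly.measurable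
    exact hstep.comp (hX.prodMk hξn)

variable [MeasurableSpace Ω] {P : Measure Ω}

theorem measurable_noisyIterate (hT : Continuous T) (hS : ∀ n, StronglyMeasurable (S n))
    (hξ : ∀ n, Measurable (ξ n)) (n : ℕ) : Measurable (noisyIterate T S ξ x₀ n) :=
  (measurable_noisyIterate_iSup_comap hT hS n).mono (iSup₂_le fun i _ => (hξ i).comap_le) le_rfl

theorem indepFun_noisyIterate (hT : Continuous T) (hS : ∀ n, StronglyMeasurable (S n))
    (hξ : ∀ n, Measurable (ξ n)) (hind : iIndepFun ξ P) (n : ℕ) :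
    IndepFun (noisyIterate T S ξ x₀ n) (ξ n) P := by
  have hpast := indep_iSup_of_disjoint (fun i => (hξ i).comap_le) hind
    (S := Set.Iio n) (T := {n}) (by simp)
  rw [iSup_singleton] at hpast
  exact indep_of_indep_of_le_left hpast (measurable_noisyIterate_iSup_comap hT hS n).comap_le

variable [IsProbabilityMeasure P]

theorem memLp_two_noisyIterate (hT : LipschitzWith ρ T) (hS : ∀ n, HasLinearGrowth (S n) z s)
    (hξ : IsCenteredNoise ξ κ P) (n : ℕ) : MemLp (noisyIterate T S ξ x₀ n) 2 P := by
  have hSm n := (hS n).stronglyMeasurable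
  induction n with
  | zero => exact memLp_const x₀
  | succ n ih =>
    exact (memLp_two_comp_of_lipschitzWith hT ih).add ((hS n).memLp_two_apply
      (measurable_noisyIterate hT.continuous hSm hξ.measurable n) ih (hξ.memLp_two n)
      (indepFun_noisyIterate hT.continuous hSm hξ.measurable hξ.iIndepFun n))

theorem integral_norm_noisyIterate_succ_sub_sq_le [CompleteSpace U] (hT : ContractingWith ρ T)
    (hS : ∀ n, HasLinearGrowth (S n) z s) (hξ : IsCenteredNoise ξ κ P) (y : V) (n : ℕ) :
    ∫ ω, ‖noisyIterate T S ξ x₀ (n + 1) ω - T y‖ ^ 2 ∂P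
      ≤ ρ * ∫ ω, ‖noisyIterate T S ξ x₀ n ω - y‖ ^ 2 ∂P
        + 2 * s ^ 2 * κ * (1 + ∫ ω, ‖noisyIterate T S ξ x₀ n ω - z‖ ^ 2 ∂P) := by
  have hSm n := (hS n).stronglyMeasurable
  have hTc := hT.toLipschitzWith.continuous
  exact integral_norm_noisyStep_sub_sq_le hT.toLipschitzWith hT.1.le (hS n)
    (measurable_noisyIterate hTc hSm hξ.measurable n)
    (memLp_two_noisyIterate hT.toLipschitzWith hS hξ n) (hξ.memLp_two n) (hξ.integral_eq_zero n)
    (hξ.integral_norm_sq_le n) (indepFun_noisyIterate hTc hSm hξ.measurable hξ.iIndepFun n) y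

theorem integral_norm_noisyIterate_sub_fixedPt_sq_le [CompleteSpace U] (hT : ContractingWith ρ T)
    (hz : Function.IsFixedPt T z) (hS : ∀ n, HasLinearGrowth (S n) z s)
    (hξ : IsCenteredNoise ξ κ P) (hs : 4 * s ^ 2 * κ ≤ 1 - ρ) (n : ℕ) :
    ∫ ω, ‖noisyIterate T S ξ x₀ n ω - z‖ ^ 2 ∂P ≤ 1 + ‖x₀ - z‖ ^ 2 := by
  have hρ : (ρ : ℝ) < 1 := hT.1
  refine le_of_contracting_recursion (ρ := (1 + ρ) / 2)
    (a := fun n => ∫ ω, ‖noisyIterate T S ξ x₀ n ω - z‖ ^ 2 ∂P) (by positivity) ?_ (fun n => ?_) n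
  · simp [noisyIterate]
  · have hstep := integral_norm_noisyIterate_succ_sub_sq_le (x₀ := x₀) hT hS hξ z n
    rw [hz] at hstep
    have hnoise : 4 * s ^ 2 * κ * (1 + ∫ ω, ‖noisyIterate T S ξ x₀ n ω - z‖ ^ 2 ∂P)
        ≤ (1 - ρ) * (1 + ∫ ω, ‖noisyIterate T S ξ x₀ n ω - z‖ ^ 2 ∂P) := by gcongr
    nlinarith [mul_nonneg (sub_nonneg.mpr hρ.le) (sq_nonneg ‖x₀ - z‖)]

theorem integral_norm_noisyIterate_sub_iterate_sq_le [CompleteSpace U] (hT : ContractingWith ρ T)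
    (hz : Function.IsFixedPt T z) (hS : ∀ n, HasLinearGrowth (S n) z s)
    (hξ : IsCenteredNoise ξ κ P) (hs : 4 * s ^ 2 * κ ≤ 1 - ρ) (n : ℕ) :
    ∫ ω, ‖noisyIterate T S ξ x₀ n ω - T^[n] x₀‖ ^ 2 ∂P
      ≤ 4 * s ^ 2 * κ / (1 - ρ) * (1 + ‖x₀ - z‖ ^ 2) := by
  have hρ : 0 < 1 - (ρ : ℝ) := sub_pos.mpr hT.1
  have hκ := hξ.nonneg
  refine le_of_contracting_recursion
    (a := fun n => ∫ ω, ‖noisyIterate T S ξ x₀ n ω - T^[n] x₀‖ ^ 2 ∂P) ρ.coe_nonneg ?_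
    (fun n => ?_) n
  · simp only [noisyIterate, Function.iterate_zero, id, sub_self, norm_zero]
    rw [zero_pow two_ne_zero, integral_zero]
    positivity
  · have hnoise : 2 * s ^ 2 * κ * (1 + ∫ ω, ‖noisyIterate T S ξ x₀ n ω - z‖ ^ 2 ∂P)
        ≤ (1 - ρ) * (4 * s ^ 2 * κ / (1 - ρ) * (1 + ‖x₀ - z‖ ^ 2)) :=
      calc 2 * s ^ 2 * κ * (1 + ∫ ω, ‖noisyIterate T S ξ x₀ n ω - z‖ ^ 2 ∂P)
          ≤ 2 * s ^ 2 * κ * (2 * (1 + ‖x₀ - z‖ ^ 2)) := by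
            gcongr
            linarith [integral_norm_noisyIterate_sub_fixedPt_sq_le (x₀ := x₀) hT hz hS hξ hs n,
              sq_nonneg ‖x₀ - z‖]
        _ = (1 - ρ) * (4 * s ^ 2 * κ / (1 - ρ) * (1 + ‖x₀ - z‖ ^ 2)) := by
            field_simp
            ring
    simp only [Function.iterate_succ_apply']
    exact (integral_norm_noisyIterate_succ_sub_sq_le hT hS hξ (T^[n] x₀) n).trans (by gcongr)

theorem integral_noisyIterate_succ [CompleteSpace U] [CompleteSpace V] (hT : LipschitzWith ρ T)
    (hS : ∀ n, HasLinearGrowth (S n) z s) (hξ : IsCenteredNoise ξ κ P) (n : ℕ) :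
    ∫ ω, noisyIterate T S ξ x₀ (n + 1) ω ∂P = ∫ ω, T (noisyIterate T S ξ x₀ n ω) ∂P := by
  have hSm n := (hS n).stronglyMeasurable
  have hX := memLp_two_noisyIterate (x₀ := x₀) hT hS hξ n
  have hXm := measurable_noisyIterate (x₀ := x₀) hT.continuous hSm hξ.measurable n
  have hind := indepFun_noisyIterate (x₀ := x₀) hT.continuous hSm hξ.measurable hξ.iIndepFun n
  have hnoise : ∫ ω, S n (noisyIterate T S ξ x₀ n ω) (ξ n ω) ∂P = 0 :=
    integral_clm_apply_eq_zero (((hS n).memLp_two_comp hXm hX).integrable one_le_two)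
      ((hξ.memLp_two n).integrable one_le_two) (hξ.integral_eq_zero n)
      (hind.comp (hSm n).measurable measurable_id)
  simp only [noisyIterate]
  rw [integral_add ((memLp_two_comp_of_lipschitzWith hT hX).integrable one_le_two)
    (((hS n).memLp_two_apply hXm hX (hξ.memLp_two n) hind).integrable one_le_two), hnoise, add_zero]

theorem norm_integral_noisyIterate_sub_iterate_le [CompleteSpace U] [CompleteSpace V]
    (hT : ContractingWith ρ T) (hTd : Differentiable ℝ T) (hTm : LipschitzWith m (fderiv ℝ T))
    (hz : Function.IsFixedPt T z) (hS : ∀ n, HasLinearGrowth (S n) z s)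
    (hξ : IsCenteredNoise ξ κ P) (hs : 4 * s ^ 2 * κ ≤ 1 - ρ) (n : ℕ) :
    ‖∫ ω, noisyIterate T S ξ x₀ n ω ∂P - T^[n] x₀‖
      ≤ m / (1 - ρ) * (4 * s ^ 2 * κ / (1 - ρ) * (1 + ‖x₀ - z‖ ^ 2)) := by
  have hρ : 0 < 1 - (ρ : ℝ) := sub_pos.mpr hT.1
  have hκ := hξ.nonneg
  refine le_of_contracting_recursion
    (a := fun n => ‖∫ ω, noisyIterate T S ξ x₀ n ω ∂P - T^[n] x₀‖) ρ.coe_nonneg ?_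
    (fun n => ?_) n
  · simp only [noisyIterate, Function.iterate_zero, id, integral_const, probReal_univ, one_smul,
      sub_self, norm_zero]
    positivity
  · have hmean := norm_integral_comp_sub_le hTd hTm
      (memLp_two_noisyIterate (x₀ := x₀) hT.toLipschitzWith hS hξ n) (T^[n] x₀)
    have hvar := integral_norm_noisyIterate_sub_iterate_sq_le (x₀ := x₀) hT hz hS hξ hs n
    simp only [Function.iterate_succ_apply', integral_noisyIterate_succ hT.toLipschitzWith hS hξ]
    rw [← mul_assoc (1 - (ρ : ℝ)), mul_div_cancel₀ _ hρ.ne']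
    exact hmean.trans (by gcongr; exact norm_fderiv_le_of_lipschitz ℝ hT.toLipschitzWith)

theorem norm_integral_comp_noisyIterate_sub_le [CompleteSpace U] [CompleteSpace V]
    {W : Type*} [NormedAddCommGroup W] [NormedSpace ℝ W] [CompleteSpace W] {φ : V → W} {K : ℝ≥0}
    (hφ : Differentiable ℝ φ) (hK : LipschitzWith K (fderiv ℝ φ))
    (hT : ContractingWith ρ T) (hTd : Differentiable ℝ T) (hTm : LipschitzWith m (fderiv ℝ T))
    (hz : Function.IsFixedPt T z) (hS : ∀ n, HasLinearGrowth (S n) z s)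
    (hξ : IsCenteredNoise ξ κ P) (hs : 4 * s ^ 2 * κ ≤ 1 - ρ) (n : ℕ) :
    ‖∫ ω, φ (noisyIterate T S ξ x₀ n ω) ∂P - φ (T^[n] x₀)‖
      ≤ (‖fderiv ℝ φ z‖ + K * ‖x₀ - z‖)
          * (m / (1 - ρ) * (4 * s ^ 2 * κ / (1 - ρ) * (1 + ‖x₀ - z‖ ^ 2)))
        + K * (4 * s ^ 2 * κ / (1 - ρ) * (1 + ‖x₀ - z‖ ^ 2)) := by
  refine (norm_integral_comp_sub_le hφ hK
    (memLp_two_noisyIterate hT.toLipschitzWith hS hξ n) (T^[n] x₀)).trans ?_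
  gcongr
  · exact norm_fderiv_le_of_norm_sub_le hK
      (norm_iterate_sub_le_of_isFixedPt hT.toLipschitzWith hT.1.le hz x₀ n)
  · exact norm_integral_noisyIterate_sub_iterate_le hT hTd hTm hz hS hξ hs n
  · exact integral_norm_noisyIterate_sub_iterate_sq_le hT hz hS hξ hs n

end NoisyIterate

section EulerStep

/-- `b` is strongly monotone with constant `μ`. -/
def StronglyMonotone {V : Type*} [NormedAddCommGroup V] [InnerProductSpace ℝ V] (b : V → V)
    (μ : ℝ) : Prop :=
  ∀ x y, μ * ‖x - y‖ ^ 2 ≤ inner ℝ (b x - b y) (x - y)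

/-- One explicit Euler step of length `h` for `x' = -b(x)`. -/
def eulerStep {V : Type*} [NormedAddCommGroup V] [NormedSpace ℝ V] (b : V → V) (h : ℝ) (x : V) :
    V :=
  x - h • b x

variable {V : Type*} [NormedAddCommGroup V]

section NormedSpace

variable [NormedSpace ℝ V] {b : V → V} {z : V} {L M : ℝ≥0}

theorem isFixedPt_eulerStep (hz : b z = 0) (h : ℝ) : Function.IsFixedPt (eulerStep b h) z := by
  rw [Function.IsFixedPt, eulerStep, hz, smul_zero, sub_zero]

theorem differentiable_eulerStep (hb : Differentiable ℝ b) (h : ℝ) :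
    Differentiable ℝ (eulerStep b h) :=
  differentiable_id.sub (hb.const_smul h)

theorem lipschitzWith_eulerStep (hL : LipschitzWith L b) (h : ℝ) :
    LipschitzWith (1 + ‖h‖₊ * L) (eulerStep b h) :=
  LipschitzWith.id.sub ((lipschitzWith_smul h).comp hL)

theorem lipschitzWith_fderiv_eulerStep (hb : Differentiable ℝ b)
    (hM : LipschitzWith M (fderiv ℝ b)) (h : ℝ) :
    LipschitzWith (‖h‖₊ * M) (fderiv ℝ (eulerStep b h)) := by
  have hfderiv : fderiv ℝ (eulerStep b h)
      = fun x => ContinuousLinearMap.id ℝ V - h • fderiv ℝ b x := by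
    funext x
    exact ((hasFDerivAt_id x).sub ((hb x).hasFDerivAt.const_smul h)).fderiv
  rw [hfderiv, ← zero_add (‖h‖₊ * M)]
  exact (LipschitzWith.const _).sub ((lipschitzWith_smul h).comp hM)

theorem norm_sub_eulerStep_le_of_isIntegralCurveOn (hL : LipschitzWith L b) (hz : b z = 0)
    {X : ℝ → V} (hX : IsIntegralCurveOn X (fun _ x => -b x) (Set.Ici 0)) {r : ℝ}
    (hr : ∀ t, 0 ≤ t → ‖X t - z‖ ≤ r) {t h : ℝ} (ht : 0 ≤ t) (hh : 0 ≤ h) :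
    ‖X (t + h) - eulerStep b h (X t)‖ ≤ L ^ 2 * r * h ^ 2 := by
  have hderiv : ∀ s ∈ Set.Icc t (t + h),
      HasDerivWithinAt X (-b (X s)) (Set.Icc t (t + h)) s := fun s hs =>
    (hX s (ht.trans hs.1)).mono fun u hu => ht.trans hu.1
  have hspeed : ∀ s, 0 ≤ s → ‖-b (X s)‖ ≤ L * r := fun s hs =>
    calc ‖-b (X s)‖ = ‖b (X s) - b z‖ := by rw [norm_neg, hz, sub_zero]
      _ ≤ L * ‖X s - z‖ := hL.norm_sub_le _ _
      _ ≤ L * r := by gcongr; exact hr s hs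
  have hincrement : ∀ s ∈ Set.Icc t (t + h), ‖X s - X t‖ ≤ L * r * h := fun s hs =>
    calc ‖X s - X t‖ ≤ L * r * (s - t) :=
          norm_image_sub_le_of_norm_deriv_le_segment' hderiv
            (fun u hu => hspeed u (ht.trans hu.1)) s hs
      _ ≤ L * r * h := by
          gcongr
          · exact (norm_nonneg _).trans (hspeed t ht)
          · linarith [hs.2]
  have hdrift : ∀ s ∈ Set.Ico t (t + h), ‖-b (X s) + (1 : ℝ) • b (X t)‖ ≤ L * (L * r * h) :=
    fun s hs =>
    calc ‖-b (X s) + (1 : ℝ) • b (X t)‖ = ‖b (X s) - b (X t)‖ := by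
          rw [one_smul, neg_add_eq_sub, norm_sub_rev]
      _ ≤ L * ‖X s - X t‖ := hL.norm_sub_le _ _
      _ ≤ L * (L * r * h) := by gcongr; exact hincrement s ⟨hs.1, hs.2.le⟩
  have hlocal := norm_image_sub_le_of_norm_deriv_le_segment' (f := fun s => X s + s • b (X t))
    (fun s hs => (hderiv s hs).add ((hasDerivWithinAt_id s _).smul_const (b (X t)))) hdrift
    (t + h) (Set.right_mem_Icc.mpr (by linarith))
  calc ‖X (t + h) - eulerStep b h (X t)‖
      = ‖X (t + h) + (t + h) • b (X t) - (X t + t • b (X t))‖ := by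
        rw [eulerStep, add_smul]; congr 1; abel
    _ ≤ L * (L * r * h) * (t + h - t) := hlocal
    _ = L ^ 2 * r * h ^ 2 := by ring

theorem norm_iterate_eulerStep_sub_le {ρ : ℝ≥0} {h : ℝ} (hL : LipschitzWith L b) (hz : b z = 0)
    (hT : ContractingWith ρ (eulerStep b h)) {X : ℝ → V}
    (hX : IsIntegralCurveOn X (fun _ x => -b x) (Set.Ici 0)) {r : ℝ}
    (hr : ∀ t, 0 ≤ t → ‖X t - z‖ ≤ r) (hh : 0 ≤ h) (n : ℕ) :
    ‖(eulerStep b h)^[n] (X 0) - X (n * h)‖ ≤ L ^ 2 * r * h ^ 2 / (1 - ρ) := by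
  have hρ : 0 < 1 - (ρ : ℝ) := sub_pos.mpr hT.1
  have hr₀ : 0 ≤ r := (norm_nonneg _).trans (hr 0 le_rfl)
  refine le_of_contracting_recursion
    (a := fun n => ‖(eulerStep b h)^[n] (X 0) - X (n * h)‖) ρ.coe_nonneg ?_ (fun n => ?_) n
  · simp only [Function.iterate_zero, id, Nat.cast_zero, zero_mul, sub_self, norm_zero]
    positivity
  · have hlocal := norm_sub_eulerStep_le_of_isIntegralCurveOn hL hz hX hr (t := n * h)
      (by positivity) hh
    have htime : ((n + 1 : ℕ) : ℝ) * h = n * h + h := by push_cast; ring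
    rw [htime, Function.iterate_succ_apply', mul_div_cancel₀ _ hρ.ne']
    calc ‖eulerStep b h ((eulerStep b h)^[n] (X 0)) - X (n * h + h)‖
        ≤ ‖eulerStep b h ((eulerStep b h)^[n] (X 0)) - eulerStep b h (X (n * h))‖
          + ‖eulerStep b h (X (n * h)) - X (n * h + h)‖ := norm_sub_le_norm_sub_add_norm_sub ..
      _ ≤ ρ * ‖(eulerStep b h)^[n] (X 0) - X (n * h)‖ + L ^ 2 * r * h ^ 2 :=
          add_le_add (hT.toLipschitzWith.norm_sub_le _ _)
            ((norm_sub_rev _ _).trans_le hlocal)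

end NormedSpace

variable [InnerProductSpace ℝ V] {b : V → V} {z : V} {L : ℝ≥0} {μ h : ℝ}

theorem StronglyMonotone.norm_eulerStep_sub_sq_le (hb : StronglyMonotone b μ)
    (hL : LipschitzWith L b) (hh : 0 ≤ h) (hhL : h * L ^ 2 ≤ μ) (x y : V) :
    ‖eulerStep b h x - eulerStep b h y‖ ^ 2 ≤ (1 - h * μ) * ‖x - y‖ ^ 2 := by
  have hquadratic : h ^ 2 * ‖b x - b y‖ ^ 2 ≤ h * μ * ‖x - y‖ ^ 2 :=
    calc h ^ 2 * ‖b x - b y‖ ^ 2 ≤ h ^ 2 * (L * ‖x - y‖) ^ 2 := by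
          gcongr; exact hL.norm_sub_le x y
      _ = h * (h * L ^ 2) * ‖x - y‖ ^ 2 := by ring
      _ ≤ h * μ * ‖x - y‖ ^ 2 := by gcongr
  have hmonotone := mul_le_mul_of_nonneg_left (hb x y) hh
  have hstep : eulerStep b h x - eulerStep b h y = (x - y) - h • (b x - b y) := by
    simp only [eulerStep, smul_sub]; abel
  rw [hstep, norm_sub_sq_real, inner_smul_right, norm_smul, mul_pow, Real.norm_eq_abs, sq_abs,
    real_inner_comm]
  linarith

theorem StronglyMonotone.exists_contractingWith_eulerStep (hb : StronglyMonotone b μ)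
    (hμ : 0 < μ) (hL : LipschitzWith L b) (hh : 0 < h) (hhL : h * L ^ 2 ≤ μ) (hhμ : h * μ ≤ 1) :
    ∃ ρ : ℝ≥0, ContractingWith ρ (eulerStep b h) ∧ 1 - (ρ : ℝ) = h * μ / 2 := by
  have hhμ₀ : 0 < h * μ := by positivity
  refine ⟨.mk (1 - h * μ / 2) (by linarith), ⟨?_, .of_dist_le_mul fun x y => ?_⟩, by simp⟩
  · rw [← NNReal.coe_lt_coe, NNReal.coe_mk, NNReal.coe_one]
    linarith
  rw [dist_eq_norm, dist_eq_norm, NNReal.coe_mk]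
  refine (pow_le_pow_iff_left₀ (norm_nonneg _) (by nlinarith [norm_nonneg (x - y)])
    two_ne_zero).mp ?_
  calc ‖eulerStep b h x - eulerStep b h y‖ ^ 2 ≤ (1 - h * μ) * ‖x - y‖ ^ 2 :=
        hb.norm_eulerStep_sub_sq_le hL hh.le hhL x y
    _ ≤ ((1 - h * μ / 2) * ‖x - y‖) ^ 2 := by
        rw [mul_pow]
        gcongr
        nlinarith [sq_nonneg (h * μ)]

theorem StronglyMonotone.norm_sub_le_of_isIntegralCurveOn (hb : StronglyMonotone b μ)
    (hμ : 0 ≤ μ) (hz : b z = 0) {X : ℝ → V}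
    (hX : IsIntegralCurveOn X (fun _ x => -b x) (Set.Ici 0)) {t : ℝ} (ht : 0 ≤ t) :
    ‖X t - z‖ ≤ ‖X 0 - z‖ := by
  have hdissipative : ∀ x, 0 ≤ inner ℝ (b x) (x - z) := fun x => by
    simpa only [hz, sub_zero] using (by positivity : 0 ≤ μ * ‖x - z‖ ^ 2).trans (hb x z)
  have hderiv : ∀ s, 0 < s → HasDerivAt (fun s => ‖X s - z‖ ^ 2)
      (2 * inner ℝ (X s - z) (-b (X s))) s := fun s hs =>
    (((hX s hs.le).hasDerivAt (Ici_mem_nhds hs)).sub_const z).norm_sq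
  have hanti : AntitoneOn (fun s => ‖X s - z‖ ^ 2) (Set.Ici 0) := by
    refine antitoneOn_of_deriv_nonpos (convex_Ici 0) (fun s hs => ?_) (fun s hs => ?_)
      fun s hs => ?_
    · exact ((hX s hs).continuousWithinAt.sub continuousWithinAt_const).norm.pow 2
    · rw [interior_Ici] at hs
      exact (hderiv s hs).differentiableAt.differentiableWithinAt
    · rw [interior_Ici] at hs
      rw [(hderiv s hs).deriv, inner_neg_right, real_inner_comm]
      linarith [hdissipative (X s)]
  exact (pow_le_pow_iff_left₀ (norm_nonneg _) (norm_nonneg _) two_ne_zero).mp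
    (hanti Set.self_mem_Ici ht ht)

theorem StronglyMonotone.norm_comp_iterate_eulerStep_sub_le {W : Type*} [NormedAddCommGroup W]
    [NormedSpace ℝ W] {φ : V → W} {K ρ : ℝ≥0} (hb : StronglyMonotone b μ)
    (hφ : Differentiable ℝ φ) (hK : LipschitzWith K (fderiv ℝ φ)) (hμ : 0 ≤ μ)
    (hL : LipschitzWith L b) (hz : b z = 0) (hh : 0 ≤ h) (hT : ContractingWith ρ (eulerStep b h))
    {X : ℝ → V} (hX : IsIntegralCurveOn X (fun _ x => -b x) (Set.Ici 0)) (n : ℕ) :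
    ‖φ ((eulerStep b h)^[n] (X 0)) - φ (X (n * h))‖
      ≤ (‖fderiv ℝ φ z‖ + K * ‖X 0 - z‖) * (L ^ 2 * ‖X 0 - z‖ * h ^ 2 / (1 - ρ)) := by
  have hXr : ∀ t, 0 ≤ t → ‖X t - z‖ ≤ ‖X 0 - z‖ := fun t ht =>
    hb.norm_sub_le_of_isIntegralCurveOn hμ hz hX ht
  have hyr : ‖(eulerStep b h)^[n] (X 0) - z‖ ≤ ‖X 0 - z‖ :=
    norm_iterate_sub_le_of_isFixedPt hT.toLipschitzWith hT.1.le (isFixedPt_eulerStep hz h) (X 0) n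
  refine (norm_sub_le_of_lipschitzWith_fderiv hφ hK hyr (hXr _ (by positivity))).trans ?_
  gcongr
  exact norm_iterate_eulerStep_sub_le hL hz hT hX hXr hh n

end EulerStep

section NoisyEuler

/-- The stochastic Euler scheme `X_{n+1} = X_n - h b(X_n) + h A(nh, X_n) ξ_n`, `X_0 = x₀`. The noise
carries a factor `h`, not `√h`. -/
def noisyEuler {Ω U V : Type*} [NormedAddCommGroup U] [NormedSpace ℝ U] [NormedAddCommGroup V]
    [NormedSpace ℝ V] (b : V → V) (A : ℝ → V → U →L[ℝ] V) (h : ℝ) (x₀ : V) (ξ : ℕ → Ω → U) :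
    ℕ → Ω → V :=
  noisyIterate (eulerStep b h) (fun n x => h • A (n * h) x) ξ x₀

/-- The drift `-b` has the globally attracting equilibrium `z`, and is regular enough for a second
order weak expansion. -/
structure IsDissipativeDrift {V : Type*} [NormedAddCommGroup V] [InnerProductSpace ℝ V]
    (b : V → V) (z : V) : Prop where
  stronglyMonotone : ∃ μ > 0, StronglyMonotone b μ
  lipschitzWith : ∃ L, LipschitzWith L b
  differentiable : Differentiable ℝ b
  lipschitzWith_fderiv : ∃ M, LipschitzWith M (fderiv ℝ b)
  eq_zero : b z = 0

theorem weak_error_terms_le {G K r a b c : ℝ} (hG : 0 ≤ G) (hK : 0 ≤ K) (hr : 0 ≤ r)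
    (ha : 0 ≤ a) (hb : 0 ≤ b) (hc : 0 ≤ c) :
    (G + K * r) * (a * (1 + r ^ 2)) + K * (b * (1 + r ^ 2)) + (G + K * r) * (c * r)
      ≤ 4 * (a + b + c) * (G + K) * (1 + r ^ 3) := by
  have hr3 : 0 ≤ r ^ 3 := pow_nonneg hr 3
  have hr1 : r ≤ 1 + r ^ 3 := by nlinarith [sq_nonneg (r - 1)]
  have hr2 : r ^ 2 ≤ 1 + r ^ 3 := by nlinarith [mul_nonneg hr (sq_nonneg (r - 1))]
  have hGK : G + K * r ≤ (G + K) * (1 + r) := by nlinarith [mul_nonneg hG hr]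
  have hKGK : K ≤ G + K := le_add_of_nonneg_left hG
  calc (G + K * r) * (a * (1 + r ^ 2)) + K * (b * (1 + r ^ 2)) + (G + K * r) * (c * r)
      ≤ (G + K) * (1 + r) * (a * (1 + r ^ 2)) + (G + K) * (b * (1 + r ^ 2))
        + (G + K) * (1 + r) * (c * r) := by gcongr
    _ = (G + K) * (a * ((1 + r) * (1 + r ^ 2)) + b * (1 + r ^ 2) + c * ((1 + r) * r)) := by ring
    _ ≤ (G + K) * (a * (4 * (1 + r ^ 3)) + b * (4 * (1 + r ^ 3)) + c * (4 * (1 + r ^ 3))) := by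
        gcongr (G + K) * (a * ?_ + b * ?_ + c * ?_) <;> nlinarith
    _ = 4 * (a + b + c) * (G + K) * (1 + r ^ 3) := by ring

variable {Ω U V W : Type*} [MeasurableSpace Ω] {P : Measure Ω} [IsProbabilityMeasure P]
  [NormedAddCommGroup U] [NormedSpace ℝ U] [MeasurableSpace U] [BorelSpace U]
  [SecondCountableTopology U]
  [NormedAddCommGroup V] [InnerProductSpace ℝ V] [MeasurableSpace V] [BorelSpace V]
  [SecondCountableTopology V]
  [NormedAddCommGroup W] [NormedSpace ℝ W]
  {b : V → V} {A : ℝ → V → U →L[ℝ] V} {ξ : ℕ → Ω → U} {φ : V → W} {x₀ z : V}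
  {μ h B κ : ℝ} {L M K : ℝ≥0}

theorem integrable_comp_noisyEuler (hφ : Differentiable ℝ φ) (hK : LipschitzWith K (fderiv ℝ φ))
    (hL : LipschitzWith L b) (hA : ∀ t, 0 ≤ t → HasLinearGrowth (A t) z B)
    (hξ : IsCenteredNoise ξ κ P) (hh : 0 ≤ h) (n : ℕ) :
    Integrable (fun ω => φ (noisyEuler b A h x₀ ξ n ω)) P :=
  integrable_comp_of_lipschitzWith_fderiv hφ hK (memLp_two_noisyIterate
    (lipschitzWith_eulerStep hL h) (fun k => (hA (k * h) (by positivity)).const_smul hh) hξ n)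

theorem norm_integral_comp_noisyEuler_sub_le [CompleteSpace U] [CompleteSpace V] [CompleteSpace W]
    (hφ : Differentiable ℝ φ) (hK : LipschitzWith K (fderiv ℝ φ)) (hμ : 0 < μ)
    (hb : StronglyMonotone b μ) (hL : LipschitzWith L b) (hbd : Differentiable ℝ b)
    (hM : LipschitzWith M (fderiv ℝ b)) (hz : b z = 0)
    (hA : ∀ t, 0 ≤ t → HasLinearGrowth (A t) z B) (hξ : IsCenteredNoise ξ κ P)
    {X : ℝ → V} (hX : IsIntegralCurveOn X (fun _ x => -b x) (Set.Ici 0))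
    (hh : 0 < h) (hhμ : h * (L ^ 2 + μ ^ 2 + 8 * B ^ 2 * κ) ≤ μ) (n : ℕ) :
    ‖∫ ω, φ (noisyEuler b A h (X 0) ξ n ω) ∂P - φ (X (n * h))‖
      ≤ 4 * (16 * M * B ^ 2 * κ / μ ^ 2 + 8 * B ^ 2 * κ / μ + 2 * L ^ 2 / μ)
        * (‖fderiv ℝ φ z‖ + K) * (1 + ‖X 0 - z‖ ^ 3) * h := by
  have hκ := hξ.nonneg
  have hnoise₀ : 0 ≤ h * (8 * B ^ 2 * κ) := by positivity
  have hhL : h * L ^ 2 ≤ μ := by nlinarith [mul_nonneg hh.le (sq_nonneg μ)]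
  have hhμ₁ : h * μ ≤ 1 := by
    have : h * μ * μ ≤ 1 * μ := by nlinarith [mul_nonneg hh.le (sq_nonneg (L : ℝ))]
    exact le_of_mul_le_mul_right this hμ
  have hhB : h * (8 * B ^ 2 * κ) ≤ μ := by
    nlinarith [mul_nonneg hh.le (sq_nonneg μ), mul_nonneg hh.le (sq_nonneg (L : ℝ))]
  have hS : ∀ k : ℕ, HasLinearGrowth (fun x => h • A (k * h) x) z (h * B) := fun k =>
    (hA (k * h) (by positivity)).const_smul hh.le
  obtain ⟨ρ, hT, hρ⟩ := hb.exists_contractingWith_eulerStep hμ hL hh hhL hhμ₁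
  have hs : 4 * (h * B) ^ 2 * κ ≤ 1 - ρ := by
    rw [hρ]
    nlinarith [mul_le_mul_of_nonneg_left hhB hh.le]
  have hweak := norm_integral_comp_noisyIterate_sub_le (x₀ := X 0) hφ hK hT
    (differentiable_eulerStep hbd h) (lipschitzWith_fderiv_eulerStep hbd hM h)
    (isFixedPt_eulerStep hz h) hS hξ hs n
  have hflow := hb.norm_comp_iterate_eulerStep_sub_le hφ hK hμ.le hL hz hh.le hT hX n
  have hterms := mul_le_mul_of_nonneg_right (weak_error_terms_le
    (norm_nonneg (fderiv ℝ φ z)) K.coe_nonneg (norm_nonneg (X 0 - z))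
    (by positivity : 0 ≤ 16 * M * B ^ 2 * κ / μ ^ 2) (by positivity : 0 ≤ 8 * B ^ 2 * κ / μ)
    (by positivity : 0 ≤ 2 * L ^ 2 / μ)) hh.le
  refine (norm_sub_le_norm_sub_add_norm_sub _ (φ ((eulerStep b h)^[n] (X 0))) _).trans
    ((add_le_add hweak hflow).trans (le_trans (le_of_eq ?_) hterms))
  rw [hρ, NNReal.coe_mul, coe_nnnorm, Real.norm_of_nonneg hh.le]
  field_simp
  ring

end NoisyEuler

section Specialization

variable {d : ℕ} {F φ : E d → ℝ} {σ : ℝ → E d → Matrix (Fin d) (Fin d) ℝ}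

theorem norm_gradient_eq_norm_fderiv (φ : E d → ℝ) (x : E d) :
    ‖gradient φ x‖ = ‖fderiv ℝ φ x‖ := by
  rw [gradient, LinearIsometryEquiv.norm_map]

theorem norm_iteratedFDeriv_two_gradient (F : E d → ℝ) (x : E d) :
    ‖iteratedFDeriv ℝ 2 (gradient F) x‖ = ‖iteratedFDeriv ℝ 3 F x‖ := by
  have hdual : ‖iteratedFDeriv ℝ 2 (gradient F) x‖ = ‖iteratedFDeriv ℝ 2 (fderiv ℝ F) x‖ :=
    (InnerProductSpace.toDual ℝ (E d)).symm.norm_iteratedFDeriv_comp_left (fderiv ℝ F) x 2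
  rw [hdual, norm_iteratedFDeriv_fderiv]

theorem tripleNorm_nonneg (m : ℕ) (φ : E d → ℝ) : 0 ≤ tripleNorm m φ :=
  Real.iSup_nonneg fun _ => by positivity

theorem BoundedDeriv.norm_iteratedFDeriv_le_tripleNorm {m : ℕ} (hφ : BoundedDeriv m φ) (x : E d) :
    ‖iteratedFDeriv ℝ m φ x‖ ≤ tripleNorm m φ := by
  obtain ⟨M, hM⟩ := hφ
  have hbdd : BddAbove (Set.range fun p : E d × (Fin m → {k : E d // k ≠ 0}) =>
      |iteratedFDeriv ℝ m φ p.1 (fun i => (p.2 i : E d))| / ∏ i, ‖(p.2 i : E d)‖) := by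
    refine ⟨M, Set.forall_mem_range.mpr fun p => ?_⟩
    rw [div_le_iff₀ (Finset.prod_pos fun i _ => norm_pos_iff.mpr (p.2 i).2)]
    exact ((iteratedFDeriv ℝ m φ p.1).le_opNorm _).trans (by gcongr; exact hM _)
  refine ContinuousMultilinearMap.opNorm_le_bound (tripleNorm_nonneg m φ) fun k => ?_
  by_cases hk : ∃ i, k i = 0
  · obtain ⟨i, hi⟩ := hk
    rw [(iteratedFDeriv ℝ m φ x).map_coord_zero i hi, norm_zero]
    exact mul_nonneg (tripleNorm_nonneg m φ) (by positivity)
  · push Not at hk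
    rw [← div_le_iff₀ (Finset.prod_pos fun i _ => norm_pos_iff.mpr (hk i))]
    exact le_ciSup hbdd (x, fun i => ⟨k i, hk i⟩)

theorem BoundedDeriv.lipschitzWith_fderiv (hφb : BoundedDeriv 2 φ) (hφ : ContDiff ℝ 2 φ) :
    LipschitzWith (NNReal.mk (tripleNorm 2 φ) (tripleNorm_nonneg 2 φ)) (fderiv ℝ φ) :=
  lipschitzWith_fderiv_of_norm_iteratedFDeriv_two_le hφ hφb.norm_iteratedFDeriv_le_tripleNorm

theorem ObjectiveAssumption.isDissipativeDrift (hF : ObjectiveAssumption F) :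
    IsDissipativeDrift (gradient F) (minimizer F) where
  stronglyMonotone := by
    obtain ⟨μ, hμ, hconv⟩ := hF.mu_convex
    exact ⟨μ, hμ, fun x y => hconv y x⟩
  lipschitzWith := by
    obtain ⟨L, hL⟩ := hF.lipschitzWith
    exact ⟨L, by simpa only [Pi.neg_def, neg_neg] using hL.neg⟩
  differentiable := hF.contDiff_gradient.differentiable two_ne_zero
  lipschitzWith_fderiv := by
    obtain ⟨M, hM⟩ := hF.bounded_third
    refine ⟨M.toNNReal, lipschitzWith_fderiv_of_norm_iteratedFDeriv_two_le hF.contDiff_gradient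
      fun x => ?_⟩
    exact (norm_iteratedFDeriv_two_gradient F x).trans_le ((hM x).trans (Real.le_coe_toNNReal M))
  eq_zero := gradient_eq_zero_of_le (minimizer_le hF)

theorem norm_toEuclideanCLM_le_frobNorm (M : Matrix (Fin d) (Fin d) ℝ) :
    ‖Matrix.toEuclideanCLM (n := Fin d) (𝕜 := ℝ) M‖ ≤ frobNorm M := by
  refine ContinuousLinearMap.opNorm_le_bound _ (Real.sqrt_nonneg _) fun v => ?_
  rw [EuclideanSpace.norm_eq, EuclideanSpace.norm_eq v, frobNorm,
    ← Real.sqrt_mul (Finset.sum_nonneg fun i _ => Finset.sum_nonneg fun j _ => sq_nonneg _),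
    Finset.sum_mul]
  refine Real.sqrt_le_sqrt (Finset.sum_le_sum fun i _ => ?_)
  simp only [Matrix.ofLp_toEuclideanCLM, Matrix.mulVec, dotProduct, Real.norm_eq_abs, sq_abs]
  exact Finset.sum_mul_sq_le_sq_mul_sq _ _ _

/-- The diffusion coefficient as an operator on the Euclidean space. -/
noncomputable def diffusionCLM (σ : ℝ → E d → Matrix (Fin d) (Fin d) ℝ) (t : ℝ) (x : E d) :
    E d →L[ℝ] E d :=
  Matrix.toEuclideanCLM (n := Fin d) (𝕜 := ℝ) (σ t x)

theorem DiffusionAssumption.continuous_diffusionCLM (hσ : DiffusionAssumption F σ) {t : ℝ}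
    (ht : 0 ≤ t) : Continuous (diffusionCLM σ t) := by
  have hσt : Continuous (σ t) := hσ.continuousOn.comp_continuous
    (f := fun x : E d => (t, x)) (by fun_prop) fun x => ⟨ht, Set.mem_univ x⟩
  have hCLM : Continuous (Matrix.toEuclideanCLM (n := Fin d) (𝕜 := ℝ)) :=
    LinearMap.continuous_of_finiteDimensional
      (Matrix.toEuclideanCLM (n := Fin d) (𝕜 := ℝ)).toAlgEquiv.toLinearMap
  exact hCLM.comp hσt

theorem DiffusionAssumption.exists_hasLinearGrowth (hσ : DiffusionAssumption F σ) :
    ∃ B, ∀ t, 0 ≤ t → HasLinearGrowth (diffusionCLM σ t) (minimizer F) B := by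
  obtain ⟨ς, -, -, hgrowth, B, hB⟩ := hσ.lipschitz_growth
  refine ⟨B, fun t ht => ⟨(hσ.continuous_diffusionCLM ht).stronglyMeasurable, fun x =>
    (norm_toEuclideanCLM_le_frobNorm _).trans ?_⟩⟩
  rw [← div_le_iff₀ (by positivity)]
  exact (hgrowth t ht x).trans (hB ⟨t, ht, rfl⟩)

theorem scheme_eq_noisyEuler {Ω : Type*} (F : E d → ℝ) (σ : ℝ → E d → Matrix (Fin d) (Fin d) ℝ)
    (h : ℝ) (x₀ : E d) (γ : ℕ → Ω → E d) :
    scheme F σ h x₀ γ = noisyEuler (gradient F) (diffusionCLM σ) h x₀ γ := by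
  funext n ω
  induction n with
  | zero => rfl
  | succ n ih => rw [scheme, ih]; rfl

theorem isCenteredNoise_of_hasLaw {Ω U : Type*} [MeasurableSpace Ω] {P : Measure Ω}
    [NormedAddCommGroup U] [NormedSpace ℝ U] [MeasurableSpace U] [BorelSpace U]
    [SecondCountableTopology U] {ν : Measure U} {ξ : ℕ → Ω → U} (hν : MemLp id 2 ν)
    (hν₀ : ∫ u, u ∂ν = 0) (hm : ∀ n, Measurable (ξ n)) (hlaw : ∀ n, HasLaw (ξ n) ν P)
    (hind : iIndepFun ξ P) : IsCenteredNoise ξ (∫ u, ‖u‖ ^ 2 ∂ν) P where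
  measurable := hm
  memLp_two n := ((hlaw n).map_eq ▸ hν).comp_of_map (hm n).aemeasurable
  integral_eq_zero n := ((hlaw n).integral_comp aestronglyMeasurable_id).trans hν₀
  integral_norm_sq_le n :=
    ((hlaw n).integral_comp (f := fun u => ‖u‖ ^ 2)
      (continuous_norm.pow 2).aestronglyMeasurable).le
  iIndepFun := hind

theorem isCenteredNoise_of_hasLaw_stdGaussian {Ω : Type*} [MeasurableSpace Ω] {P : Measure Ω}
    {γ : ℕ → Ω → E d} (hγm : ∀ n, Measurable (γ n))
    (hγ : ∀ n, HasLaw (γ n) (stdGaussian (E d)) P) (hind : iIndepFun γ P) :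
    IsCenteredNoise γ (∫ v, ‖v‖ ^ 2 ∂stdGaussian (E d)) P :=
  isCenteredNoise_of_hasLaw (ν := stdGaussian (E d)) IsGaussian.memLp_two_id
    integral_id_stdGaussian hγm hγ hind

end Specialization

end StochGradScheme

theorem proposition4p2_general {U V W : Type*} [NormedAddCommGroup U] [NormedSpace ℝ U]
    [CompleteSpace U] [MeasurableSpace U] [BorelSpace U] [SecondCountableTopology U]
    [NormedAddCommGroup V] [InnerProductSpace ℝ V] [CompleteSpace V] [MeasurableSpace V]
    [BorelSpace V] [SecondCountableTopology V] [NormedAddCommGroup W] [NormedSpace ℝ W]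
    [CompleteSpace W] {b : V → V} {A : ℝ → V → U →L[ℝ] V} {z : V} {hmax : ℝ}
    (hmax_pos : 0 < hmax) (hb : IsDissipativeDrift b z)
    (hA : ∃ B, ∀ t, 0 ≤ t → HasLinearGrowth (A t) z B) (κ : ℝ≥0) :
    ∃ H ∈ Set.Ioo 0 hmax, ∃ C : ℝ, 0 < C ∧
      ∀ (φ : V → W) (K : ℝ≥0), Differentiable ℝ φ → LipschitzWith K (fderiv ℝ φ) →
      ∀ X : ℝ → V, IsIntegralCurveOn X (fun _ x => -b x) (Set.Ici 0) → ∀ h ∈ Set.Ioo 0 H,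
      ∀ (Ω : Type*) [MeasurableSpace Ω] (P : Measure Ω) [IsProbabilityMeasure P]
        (ξ : ℕ → Ω → U), IsCenteredNoise ξ κ P → ∀ N : ℕ,
        Integrable (fun ω => φ (noisyEuler b A h (X 0) ξ N ω)) P ∧
        ‖∫ ω, φ (noisyEuler b A h (X 0) ξ N ω) ∂P - φ (X (N * h))‖
          ≤ C * (‖fderiv ℝ φ z‖ + K) * (1 + ‖X 0 - z‖ ^ 3) * h := by
  obtain ⟨μ, hμ, hmono⟩ := hb.stronglyMonotone
  obtain ⟨L, hL⟩ := hb.lipschitzWith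
  obtain ⟨M, hM⟩ := hb.lipschitzWith_fderiv
  obtain ⟨B, hA⟩ := hA
  have hD : 0 < (L : ℝ) ^ 2 + μ ^ 2 + 8 * B ^ 2 * κ := by positivity
  set C := 4 * (16 * M * B ^ 2 * κ / μ ^ 2 + 8 * B ^ 2 * κ / μ + 2 * L ^ 2 / μ)
  refine ⟨min (hmax / 2) (μ / (L ^ 2 + μ ^ 2 + 8 * B ^ 2 * κ)),
    ⟨by positivity, (min_le_left _ _).trans_lt (half_lt_self hmax_pos)⟩, C + 1, by positivity, ?_⟩
  rintro φ K hφ hK X hX h ⟨hh, hhH⟩ Ω _ P _ ξ hξ N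
  have hhμ := ((lt_div_iff₀ hD).mp (hhH.trans_le (min_le_right _ _))).le
  refine ⟨integrable_comp_noisyEuler hφ hK hL hA hξ hh.le N,
    (norm_integral_comp_noisyEuler_sub_le hφ hK hμ hmono hL hb.differentiable hM hb.eq_zero hA hξ hX
      hh hhμ N).trans ?_⟩
  gcongr
  exact (lt_add_one C).le

theorem proposition4p2 {d : ℕ} (hd : 0 < d) (hmax : ℝ) (hmax_pos : 0 < hmax)
    (F : E d → ℝ) (σ : ℝ → E d → Matrix (Fin d) (Fin d) ℝ)
    (hF : ObjectiveAssumption F) (hσ : DiffusionAssumption F σ) :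
    ∃ H ∈ Set.Ioo 0 hmax, ∃ C : ℝ, 0 < C ∧
      ∀ φ : E d → ℝ, ContDiff ℝ 2 φ → BoundedDeriv 2 φ → ∀ x₀ : E d, ∀ h ∈ Set.Ioo 0 H,
      ∀ (Ω : Type*) [MeasurableSpace Ω] (P : Measure Ω) [IsProbabilityMeasure P]
        (γ : ℕ → Ω → E d), (∀ n, Measurable (γ n)) →
        (∀ n, HasLaw (γ n) (stdGaussian (E d)) P) → iIndepFun γ P →
      ∀ N : ℕ, 1 ≤ N →
        Integrable (fun ω => φ (scheme F σ h x₀ γ N ω)) P ∧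
        |(∫ ω, φ (scheme F σ h x₀ γ N ω) ∂P) - φ (gradientFlow F x₀ (N * h))|
          ≤ weakConst F C φ x₀ * h := by
  obtain ⟨H, hH, C, hC, hweak⟩ := proposition4p2_general (W := ℝ) hmax_pos hF.isDissipativeDrift
    hσ.exists_hasLinearGrowth
    (.mk (∫ v, ‖v‖ ^ 2 ∂stdGaussian (E d)) (integral_nonneg fun _ => sq_nonneg _))
  refine ⟨H, hH, C, hC, fun φ hφ hφb x₀ h hh Ω _ P _ γ hγm hγ hind N _ => ?_⟩
  obtain ⟨hX₀, hX⟩ := isGradientFlow_gradientFlow hF x₀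
  have hN := hweak φ _ (hφ.differentiable two_ne_zero) (hφb.lipschitzWith_fderiv hφ) _ hX h hh Ω P γ
    (isCenteredNoise_of_hasLaw_stdGaussian hγm hγ hind) N
  rwa [hX₀, ← norm_gradient_eq_norm_fderiv, ← scheme_eq_noisyEuler] at hN
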